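/- Let $\epsilon>0$, $\lambda\ge 0$, and let $K,d,N$ be natural numbers. A data set is a tuple $D=((x_i,y_i))_{i=1}^N$ with $x_i\in\mathbb R^d$ and labels $y_i\in[-1,1]$ (in particular $y_i\in\{-1,1\}$); two data sets are neighbours if they have the same size and differ in the value of at most one sample. A randomized mechanism $M$ is $\epsilon$-differentially private if $\Pr(M(D)\in T)\le e^{\epsilon}\Pr(M(D')\in T)$ for all neighbouring $D,D'$ and all measurable sets $T$ of outputs. *PLR.* Let $g:\mathbb R^m\to\mathbb R$ be a regularizer. Given $n\ge1$ samples $(x_i,y_i)$ in $\mathbb R^m\times[-1,1]$, put $\epsilon'=\epsilon-\log\bigl(1+\frac1{2n\lambda}+\frac1{16n^2\lambda^2}\bigr)$ (which is $-\infty$ if $\lambda=0$). If $\epsilon'>0$, let $\Delta=0$; otherwise let $\Delta=\frac{1}{4n(e^{\epsilon/4}-1)}-\lambda$ and reset $\epsilon'=\epsilon/2$. Scale every $x_i$ to norm at most $1$ by a fixed rule $x\mapsto c(x)x$, with $c>0$ measurable and $\|c(x)x\|\le1$, that is applied to each sample separately. Draw $b\in\mathbb R^m$ with density proportional to $\exp(-\epsilon'\|b\|/2)$,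 and output $$w=\arg\min_{w\in\mathbb R^m}\ \frac1n\sum_{i=1}^n\log\bigl(1+e^{-y_iw^\top x_i}\bigr)+\frac{b^\top w}{n}+\frac{\Delta\|w\|^2}{2}+\lambda g(w),$$ where the $x_i$ are the scaled samples. *PST-S.* Fix a partition of the index set $\{1,\dots,N\}$, not depending on the data, into non-empty sets; it splits $D$ into disjoint sets $\mathcal S_1,\dots,\mathcal S_K$ (low level) and $D^h$ (high level). Run PLR with budget $\epsilon$ and a regularizer $g$ on $\mathbb R^d$ independently on each $\mathcal S_k$, to get $w_1^l,\dots,w_K^l$. With $\sigma(a)=e^a/(1+e^a)$, form the meta-data set of all $\bigl([\sigma(x^\top w_1^l);\dots;\sigma(x^\top w_K^l)],\,y\bigr)$ with $(x,y)\in D^h$, and run PLR with budget $\epsilon$, a regularizer $g^h$ on $\mathbb R^K$ and fresh independent noise on it, to get $w^h$. Output $(w_1^l,\dots,w_K^l,w^h)$. **Proposition.** If the regularizers $g$ and $g^h$ are $1$-strongly convex, that is, $g(\alpha w+(1-\alpha)u)\le\alpha g(w)+(1-\alpha)g(u)-\frac12\alpha(1-\alpha)\|w-u\|^2$ for all $w,u$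 and $\alpha\in(0,1)$ (and likewise for $g^h$), then PST-S is $\epsilon$-differentially private: its joint output $(w_1^l,\dots,w_K^l,w^h)$ is an $\epsilon$-differentially private function of $D$. -/

import Mathlib

open MeasureTheory
open scoped ENNReal

namespace PrivStack

/-- The space `ℝ^d` with its Euclidean norm. -/
abbrev Vec (d : ℕ) : Type := EuclideanSpace ℝ (Fin d)

/-- A labelled sample `(x, y)` with `x ∈ ℝ^d` and `y ∈ [-1, 1]`; the class labels `y = ±1` are
the main case. -/
abbrev Sample (d : ℕ) : Type := Vec d × Set.Icc (-1 : ℝ) 1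

/-! ### Differential privacy -/

/-- Two data sets of the same size differ by (at most) one element. -/
def Neighbors {ι α : Type*} (D D' : ι → α) : Prop :=
  ∃ i, ∀ j, j ≠ i → D j = D' j

/-- A randomized mechanism `M`, given by the law `M D` of its output on each data set `D`, is
`ε`-differentially private: each `M D` is a probability law, and for neighbouring data sets
`Pr(M(D) ∈ T) ≤ e^ε Pr(M(D') ∈ T)` for every measurable set `T` of outputs. -/
def IsDifferentiallyPrivate {ι α β : Type*} [MeasurableSpace β] (ε : ℝ)
    (M : (ι → α) → Measure β) : Prop :=
  (∀ D, IsProbabilityMeasure (M D)) ∧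
    ∀ D D', Neighbors D D' → ∀ T : Set β, MeasurableSet T →
      M D T ≤ ENNReal.ofReal (Real.exp ε) * M D' T

/-! ### Privacy-preserving logistic regression (PLR) -/

/-- The logistic loss `ℓ(ŷ, y) = log (1 + e^(-y ŷ))`. -/
noncomputable def logisticLoss (yhat y : ℝ) : ℝ :=
  Real.log (1 + Real.exp (-(y * yhat)))

/-- A rule that scales each sample vector, on its own, into the unit ball: `x` is replaced by
`factor x • x`. For instance `factor x = 1 / max 1 ‖x‖`, or `factor x = 1 / R` for `‖x‖ ≤ R` with
a public bound `R`. -/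
structure ScalingRule (d : ℕ) where
  factor : Vec d → ℝ
  factor_pos : ∀ x, 0 < factor x
  measurable_factor : Measurable factor
  norm_le_one : ∀ x, ‖factor x • x‖ ≤ 1

/-- The scaled sample. -/
def ScalingRule.apply {d : ℕ} (s : ScalingRule d) (z : Sample d) : Sample d :=
  (s.factor z.1 • z.1, z.2)

/-- The test `ε - log (1 + 1/(2nλ) + 1/(16n²λ²)) > 0` of PLR. For `λ = 0` the left-hand side is
`-∞`, so that the test fails. -/
def SlackPositive (ε lam : ℝ) (n : ℕ) : Prop :=
  0 < lam ∧
    0 < ε - Real.log (1 + 1 / (2 * (n : ℝ) * lam) + 1 / (16 * (n : ℝ) ^ 2 * lam ^ 2))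

open Classical in
/-- The modified privacy budget `ε'` of PLR. -/
noncomputable def modifiedBudget (ε lam : ℝ) (n : ℕ) : ℝ :=
  if SlackPositive ε lam n then
    ε - Real.log (1 + 1 / (2 * (n : ℝ) * lam) + 1 / (16 * (n : ℝ) ^ 2 * lam ^ 2))
  else ε / 2

open Classical in
/-- The extra quadratic weight `Δ` of PLR. -/
noncomputable def extraWeight (ε lam : ℝ) (n : ℕ) : ℝ :=
  if SlackPositive ε lam n then 0
  else (4 * (n : ℝ) * (Real.exp (ε / 4) - 1))⁻¹ - lam

/-- The probability law on `ℝ^d` whose density is proportional to `exp (-c ‖b‖)`. -/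
noncomputable def expNormLaw (d : ℕ) (c : ℝ) : Measure (Vec d) :=
  (∫⁻ b : Vec d, ENNReal.ofReal (Real.exp (-(c * ‖b‖))))⁻¹ •
    (volume : Measure (Vec d)).withDensity
      (fun b => ENNReal.ofReal (Real.exp (-(c * ‖b‖))))

/-- The perturbed objective
`(1/n) ∑ ℓ(wᵀxᵢ, yᵢ) + bᵀw / n + Δ ‖w‖² / 2 + λ g(w)`, where `n` is the size of `D`. -/
noncomputable def objective {ι : Type} [Fintype ι] {d : ℕ} (lam Δ : ℝ) (g : Vec d → ℝ)
    (D : ι → Sample d) (b w : Vec d) : ℝ :=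
  1 / (Fintype.card ι : ℝ) * ∑ i, logisticLoss (inner ℝ w (D i).1) ((D i).2 : ℝ)
    + inner ℝ b w / (Fintype.card ι : ℝ) + Δ * ‖w‖ ^ 2 / 2 + lam * g w

/-- A global minimizer of `f` (arbitrary if there is none). -/
noncomputable def argmin {d : ℕ} (f : Vec d → ℝ) : Vec d :=
  Classical.epsilon fun w => ∀ v, f w ≤ f v

/-- PLR with privacy budget `ε`, hyperparameter `λ`, regularizer `g` and scaling rule `s`: the
law of the parameter vector that it outputs on the data set `D`. -/
noncomputable def plr {ι : Type} [Fintype ι] {d : ℕ} (ε lam : ℝ) (g : Vec d → ℝ)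
    (s : ScalingRule d) (D : ι → Sample d) : Measure (Vec d) :=
  (expNormLaw d (modifiedBudget ε lam (Fintype.card ι) / 2)).map fun b =>
    argmin (objective lam (extraWeight ε lam (Fintype.card ι)) g (fun i => s.apply (D i)) b)

/-! ### Privacy-preserving stacking with sample partitioning (PST-S)

The partition of the `N` samples is given by a map `part : Fin N → Option (Fin K)`: sample `i`
belongs to the high-level set if `part i = none`, and to the `k`-th low-level set if
`part i = some k`. -/

/-- The part of the data set `D` with label `p`. -/
def subData {N K : ℕ} {α : Type} (part : Fin N → Option (Fin K)) (p : Option (Fin K))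
    (D : Fin N → α) : {i : Fin N // part i = p} → α :=
  fun i => D i

/-- The meta-sample `([σ(xᵀw₁); …; σ(xᵀw_K)], y)` of a sample `(x, y)`. -/
noncomputable def metaSample {d K : ℕ} (w : Fin K → Vec d) (z : Sample d) : Sample K :=
  (WithLp.toLp 2 fun k => Real.sigmoid (inner ℝ z.1 (w k)), z.2)

/-- PST-S: the joint law of its output `((w₁, …, w_K), w_h)` on the data set `D`. The low-level
parameters come from independent runs of PLR on the low-level sets; given these parameters,
`w_h` comes from a fresh run of PLR on the meta-data set built from the high-level set. -/
noncomputable def pstS {N K d : ℕ} (ε lam : ℝ) (gLow : Vec d → ℝ) (gHigh : Vec K → ℝ)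
    (sLow : ScalingRule d) (sHigh : ScalingRule K) (part : Fin N → Option (Fin K))
    (D : Fin N → Sample d) : Measure ((Fin K → Vec d) × Vec K) :=
  (Measure.pi fun k : Fin K => plr ε lam gLow sLow (subData part (some k) D)).bind fun w =>
    (plr ε lam gHigh sHigh (fun i => metaSample w (subData part none D i))).map
      fun v => (w, v)

end PrivStack

/-!
Let `w(b)` minimize `H + ⟪b, ·⟫`, where `H` is `m`-strongly convex. Adding a convex loss `L ⟪·, v⟫`
to `H` leaves the minimizer in place once the noise moves from `b` to `b + f(b) v`, where
`f(b) = -L' ⟪w(b), v⟫`. Strong convexity makes `t ↦ ⟪w(b + t v), v⟫` antitone and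
`1/m`-Lipschitz for `‖v‖ ≤ 1`, so on every line parallel to `v` this shear is `t ↦ t + f` with `f`
monotone and `β/m`-Lipschitz, `β` being a Lipschitz constant of `L'`: it contracts no length, and
expands it by at most the factor `1 + β/m`. No Jacobian is needed; Fubini along the lines shows what
the shear does to Lebesgue measure. As `|f| ≤ ρ`, where `ρ` bounds `|L'|`, the noise density, which
is proportional to `exp (-c ‖b‖)`, changes by a factor of at most `exp (c ρ)`.

For the logistic loss `ρ = 1` and `β = 1/4`, and the noise has `c = ε'/2`. Removing one loss term
and adding another therefore costs `exp ε' * (1 + 1 / (4 n (Δ + λ)))`, and `ε'` and `Δ` are chosen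
to make this at most `exp ε`.

In PST-S a sample lies in exactly one part. If that part is low-level, the high-level stage is
post-processing; if it is high-level, the low-level laws agree and the bound holds for each value of
the low-level parameters. The budget is thus spent only once.
-/

namespace PrivStack

open Filter Metric Set
open scoped NNReal Topology

/-! ### Strongly convex functions and their minimizers -/

section StrongConvexity

variable {E : Type*} [NormedAddCommGroup E] [NormedSpace ℝ E] {s : Set E} {m : ℝ} {f g : E → ℝ}

theorem strongConvexOn_add_convexOn (hf : StrongConvexOn s m f) (hg : ConvexOn ℝ s g) :
    StrongConvexOn s m fun u => f u + g u := by
  simpa only [StrongConvexOn, add_zero] using! UniformConvexOn.add hf (uniformConvexOn_zero.2 hg)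

theorem strongConvexOn_quadratic_growth (hf : StrongConvexOn s m f) {w u : E} (hws : w ∈ s)
    (hw : IsMinOn f s w) (hu : u ∈ s) : f w + m / 2 * ‖u - w‖ ^ 2 ≤ f u := by
  have growth_on_segment : ∀ a ∈ Ioo (0 : ℝ) 1, f w + (1 - a) * (m / 2 * ‖u - w‖ ^ 2) ≤ f u := by
    rintro a ⟨ha0, ha1⟩
    have hmem := hf.1 hu hws ha0.le (sub_nonneg.2 ha1.le) (add_sub_cancel a 1)
    have hconv := hf.2 hu hws ha0.le (sub_nonneg.2 ha1.le) (add_sub_cancel a 1)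
    have hmin : f w ≤ f (a • u + (1 - a) • w) := hw hmem
    simp only [smul_eq_mul] at hconv
    exact le_of_mul_le_mul_left (by linarith) ha0
  have tendsto_bound : Tendsto (fun a : ℝ => f w + (1 - a) * (m / 2 * ‖u - w‖ ^ 2)) (𝓝[>] 0)
      (𝓝 (f w + (1 - 0) * (m / 2 * ‖u - w‖ ^ 2))) :=
    (Continuous.tendsto (by fun_prop) 0).mono_left nhdsWithin_le_nhds
  simpa only [sub_zero, one_mul] using le_of_tendsto tendsto_bound
    (eventually_of_mem (Ioo_mem_nhdsGT one_pos) growth_on_segment)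

theorem strongConvexOn_radial_growth (hf : StrongConvexOn univ m f) {a : ℝ}
    (ha : ∀ u ∈ closedBall 0 1, a ≤ f u) {u : E} (hu : 1 ≤ ‖u‖) :
    f 0 + ‖u‖ * (a - f 0 + m / 2 * (‖u‖ - 1)) ≤ f u := by
  have hpos : 0 < ‖u‖ := one_pos.trans_le hu
  have hconv := hf.2 (mem_univ u) (mem_univ 0) (inv_nonneg.2 hpos.le)
    (sub_nonneg.2 (inv_le_one_of_one_le₀ hu)) (add_sub_cancel _ _)
  have ha' : a ≤ f (‖u‖⁻¹ • u) := ha _ (by simp [norm_smul, hpos.ne'])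
  simp only [smul_eq_mul, smul_zero, add_zero, sub_zero] at hconv
  calc f 0 + ‖u‖ * (a - f 0 + m / 2 * (‖u‖ - 1))
      = ‖u‖ * (a - (1 - ‖u‖⁻¹) * f 0 + ‖u‖⁻¹ * (1 - ‖u‖⁻¹) * (m / 2 * ‖u‖ ^ 2)) := by
        field_simp
        ring
    _ ≤ ‖u‖ * (‖u‖⁻¹ * f u) := by gcongr; linarith
    _ = f u := mul_inv_cancel_left₀ hpos.ne' _

theorem exists_isMinOn_of_strongConvexOn [FiniteDimensional ℝ E] (hf : StrongConvexOn univ m f)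
    (hm : 0 < m) : ∃ w, IsMinOn f univ w := by
  have : ProperSpace E := FiniteDimensional.proper ℝ E
  have hcont : Continuous f := (hf.strictConvexOn hm).convexOn.locallyLipschitz.continuous
  obtain ⟨z, -, hz⟩ :=
    (isCompact_closedBall (0 : E) 1).exists_isMinOn (nonempty_closedBall.2 zero_le_one)
      hcont.continuousOn
  have sublevel_subset : {u | f u ≤ f 0} ⊆ closedBall 0 (1 + 2 * (f 0 - f z) / m) := by
    intro u (hu : f u ≤ f 0)
    rw [mem_closedBall_zero_iff]
    by_contra! hfar
    have hz0 : 0 ≤ f 0 - f z := sub_nonneg.2 (hz (mem_closedBall_self zero_le_one))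
    have hu1 : 1 ≤ ‖u‖ := le_trans (le_add_of_nonneg_right (by positivity)) hfar.le
    have hgrowth := strongConvexOn_radial_growth hf (fun _ hv => hz hv) hu1
    have hslope : 0 < f z - f 0 + m / 2 * (‖u‖ - 1) := by
      rw [← lt_sub_iff_add_lt', div_lt_iff₀ hm] at hfar
      linarith
    have : 0 < ‖u‖ * (f z - f 0 + m / 2 * (‖u‖ - 1)) := by positivity
    linarith
  obtain ⟨w, hw⟩ :=
    hcont.exists_forall_le_of_isBounded 0 (isBounded_closedBall.subset sublevel_subset)
  exact ⟨w, fun v _ => hw v⟩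

theorem mem_ball_of_forall_mem_sphere_lt (hf : ConvexOn ℝ univ f) {w v : E} {r : ℝ} (hr : 0 < r)
    (hsphere : ∀ u ∈ sphere w r, f w < f u) (hv : f v ≤ f w) : v ∈ ball w r := by
  by_contra! hfar
  rw [mem_ball, dist_eq_norm, not_lt] at hfar
  have hR : 0 < ‖v - w‖ := hr.trans_le hfar
  obtain ⟨a, ha0, ha1, haR⟩ : ∃ a, 0 ≤ a ∧ a ≤ 1 ∧ a * ‖v - w‖ = r :=
    ⟨r / ‖v - w‖, by positivity, (div_le_one hR).2 hfar, div_mul_cancel₀ r hR.ne'⟩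
  have hmem : (1 - a) • w + a • v ∈ sphere w r := by
    rw [mem_sphere, dist_eq_norm, ← haR, show (1 - a) • w + a • v - w = a • (v - w) by module,
      norm_smul, Real.norm_of_nonneg ha0]
  refine (hsphere _ hmem).not_ge ?_
  calc f ((1 - a) • w + a • v) ≤ (1 - a) * f w + a * f v :=
        hf.2 (mem_univ w) (mem_univ v) (sub_nonneg.2 ha1) ha0 (sub_add_cancel 1 a)
    _ ≤ (1 - a) * f w + a * f w := by gcongr
    _ = f w := by ring

theorem continuous_of_isMinOn [ProperSpace E] {X : Type*} [TopologicalSpace X] {F : X → E → ℝ}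
    (hF : Continuous (Function.uncurry F)) (hconv : ∀ x, StrictConvexOn ℝ univ (F x)) {w : X → E}
    (hw : ∀ x, IsMinOn (F x) univ (w x)) : Continuous w := by
  refine continuous_iff_continuousAt.2 fun x => Metric.tendsto_nhds.2 fun r hr => ?_
  have lt_on_sphere : ∀ u ∈ sphere (w x) r, F x (w x) < F x u := fun u hu =>
    (hw x (mem_univ u)).lt_of_ne fun heq => ne_of_mem_sphere hu hr.ne' <|
      (hconv x).eq_of_isMinOn (fun v hv => heq ▸ hw x hv) (hw x) trivial trivial
  have lt_on_sphere_nearby : ∀ᶠ x' in 𝓝 x, ∀ u ∈ sphere (w x) r, F x' (w x) < F x' u :=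
    (isCompact_sphere (w x) r).eventually_forall_of_forall_eventually fun u hu =>
      Tendsto.eventually_lt
        (hF.comp (continuous_fst.prodMk continuous_const)).continuousAt hF.continuousAt
        (lt_on_sphere u hu)
  filter_upwards [lt_on_sphere_nearby] with x' hx'
  exact mem_ball_of_forall_mem_sphere_lt (hconv x').convexOn hr hx' (hw x' (mem_univ _))

end StrongConvexity

section Argmin

variable {d : ℕ} {m : ℝ} {f : Vec d → ℝ}

theorem isMinOn_argmin (hf : ∃ w, IsMinOn f univ w) : IsMinOn f univ (argmin f) := fun v _ =>
  Classical.epsilon_spec (p := fun w => ∀ v, f w ≤ f v) (hf.imp fun _ hw v => hw (mem_univ v)) v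

theorem argmin_eq_of_isMinOn (hf : StrictConvexOn ℝ univ f) {w : Vec d} (hw : IsMinOn f univ w) :
    argmin f = w :=
  hf.eq_of_isMinOn (isMinOn_argmin ⟨w, hw⟩) hw trivial trivial

theorem argmin_const_mul {a : ℝ} (ha : 0 < a) (f : Vec d → ℝ) :
    argmin (fun w => a * f w) = argmin f := by
  simp only [argmin, mul_le_mul_iff_right₀ ha]

theorem continuous_argmin {X : Type*} [TopologicalSpace X] {F : X → Vec d → ℝ}
    (hF : Continuous (Function.uncurry F)) (hm : 0 < m) (hconv : ∀ x, StrongConvexOn univ m (F x)) :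
    Continuous fun x => argmin (F x) :=
  continuous_of_isMinOn hF (fun x => (hconv x).strictConvexOn hm) fun x =>
    isMinOn_argmin (exists_isMinOn_of_strongConvexOn (hconv x) hm)

end Argmin

/-! ### Minimizers of linearly perturbed objectives -/

section LinearPerturbation

variable {E : Type*} [NormedAddCommGroup E] [InnerProductSpace ℝ E] {m : ℝ} {H : E → ℝ}

theorem strongConvexOn_add_inner (hH : StrongConvexOn univ m H) (b : E) :
    StrongConvexOn univ m fun u => H u + inner ℝ b u :=
  strongConvexOn_add_convexOn hH ((innerₗ E b).convexOn convex_univ)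

theorem mul_norm_sub_sq_le_of_isMinOn (hH : StrongConvexOn univ m H) {b b' w w' : E}
    (hw : IsMinOn (fun u => H u + inner ℝ b u) univ w)
    (hw' : IsMinOn (fun u => H u + inner ℝ b' u) univ w') :
    m * ‖w' - w‖ ^ 2 ≤ -inner ℝ (b' - b) (w' - w) := by
  have growth_from_w := strongConvexOn_quadratic_growth (strongConvexOn_add_inner hH b) trivial hw
    (mem_univ w')
  have growth_from_w' := strongConvexOn_quadratic_growth (strongConvexOn_add_inner hH b') trivial
    hw' (mem_univ w)
  rw [norm_sub_rev] at growth_from_w'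
  simp only [inner_sub_left, inner_sub_right]
  linarith

theorem add_deriv_mul_sub_le_of_convexOn {L : ℝ → ℝ} (hL : ConvexOn ℝ univ L) {t : ℝ}
    (ht : DifferentiableAt ℝ L t) (s : ℝ) : L t + deriv L t * (s - t) ≤ L s := by
  rcases lt_trichotomy t s with hts | rfl | hst
  · have hslope := hL.deriv_le_slope trivial trivial hts ht
    rw [slope_def_field, le_div_iff₀ (sub_pos.2 hts)] at hslope
    linarith
  · simp
  · have hslope := hL.slope_le_deriv trivial trivial hst ht
    rw [slope_def_field, div_le_iff₀ (sub_pos.2 hst)] at hslope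
    linarith

theorem isMinOn_add_comp_inner {L : ℝ → ℝ} (hL : ConvexOn ℝ univ L) {b v w : E}
    (hdiff : DifferentiableAt ℝ L (inner ℝ w v))
    (hw : IsMinOn (fun u => H u + inner ℝ b u) univ w) :
    IsMinOn (fun u => H u + L (inner ℝ u v) +
      inner ℝ (b + (-deriv L (inner ℝ w v)) • v) u) univ w := by
  refine isMinOn_univ_iff.2 fun u => ?_
  have hmin := isMinOn_univ_iff.1 hw u
  have htangent := add_deriv_mul_sub_le_of_convexOn hL hdiff (inner ℝ u v)
  simp only [inner_add_left, real_inner_smul_left, real_inner_comm v] at *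
  linarith

end LinearPerturbation

section PerturbedArgmin

variable {d : ℕ} {m : ℝ≥0} {H : Vec d → ℝ}

/-- The minimizer of `H + ⟪b, ·⟫`, as a function of the linear perturbation `b`. -/
noncomputable def perturbedArgmin (H : Vec d → ℝ) (b : Vec d) : Vec d :=
  argmin fun u => H u + inner ℝ b u

theorem isMinOn_perturbedArgmin (hm : 0 < m) (hH : StrongConvexOn univ m H) (b : Vec d) :
    IsMinOn (fun u => H u + inner ℝ b u) univ (perturbedArgmin H b) :=
  isMinOn_argmin (exists_isMinOn_of_strongConvexOn (strongConvexOn_add_inner hH b) hm)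

theorem mul_norm_perturbedArgmin_sub_sq_le (hm : 0 < m) (hH : StrongConvexOn univ m H)
    (b b' : Vec d) :
    m * ‖perturbedArgmin H b' - perturbedArgmin H b‖ ^ 2 ≤
      -inner ℝ (b' - b) (perturbedArgmin H b' - perturbedArgmin H b) :=
  mul_norm_sub_sq_le_of_isMinOn hH (isMinOn_perturbedArgmin hm hH b)
    (isMinOn_perturbedArgmin hm hH b')

theorem lipschitzWith_perturbedArgmin (hm : 0 < m) (hH : StrongConvexOn univ m H) :
    LipschitzWith m⁻¹ (perturbedArgmin H) := by
  refine LipschitzWith.of_dist_le_mul fun b' b => ?_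
  rw [dist_eq_norm, dist_eq_norm, NNReal.coe_inv, ← div_eq_inv_mul,
    le_div_iff₀' (by exact_mod_cast hm)]
  have hle : m * ‖perturbedArgmin H b' - perturbedArgmin H b‖ ^ 2 ≤
      ‖b' - b‖ * ‖perturbedArgmin H b' - perturbedArgmin H b‖ :=
    (mul_norm_perturbedArgmin_sub_sq_le hm hH b b').trans
      ((neg_le_abs _).trans (abs_real_inner_le_norm _ _))
  rcases (norm_nonneg (perturbedArgmin H b' - perturbedArgmin H b)).eq_or_lt with h0 | hpos
  · simp only [← h0, mul_zero, norm_nonneg]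
  · exact le_of_mul_le_mul_right (by linarith) hpos

theorem antitone_inner_perturbedArgmin_line (hm : 0 < m) (hH : StrongConvexOn univ m H)
    (b v : Vec d) : Antitone fun t : ℝ => inner ℝ (perturbedArgmin H (b + t • v)) v := by
  intro s t hst
  rcases hst.eq_or_lt with rfl | hst
  · rfl
  have hle := mul_norm_perturbedArgmin_sub_sq_le hm hH (b + s • v) (b + t • v)
  rw [add_sub_add_left_eq_sub, ← sub_smul, real_inner_smul_left, real_inner_comm,
    inner_sub_left] at hle
  have hsq : 0 ≤ (m : ℝ) *
      ‖perturbedArgmin H (b + t • v) - perturbedArgmin H (b + s • v)‖ ^ 2 := by positivity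
  exact sub_nonpos.1 (nonpos_of_mul_nonpos_right (by linarith) (sub_pos.2 hst))

theorem lipschitzWith_inner_perturbedArgmin_line (hm : 0 < m) (hH : StrongConvexOn univ m H)
    (b v : Vec d) :
    LipschitzWith (‖v‖₊ * (m⁻¹ * ‖v‖₊))
      fun t : ℝ => inner ℝ (perturbedArgmin H (b + t • v)) v := by
  have hinner : LipschitzWith ‖v‖₊ fun u : Vec d => inner ℝ u v := by
    refine LipschitzWith.of_dist_le_mul fun u u' => ?_
    rw [Real.dist_eq, ← inner_sub_left, dist_eq_norm, mul_comm]
    exact abs_real_inner_le_norm _ _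
  have hline : LipschitzWith ‖v‖₊ fun t : ℝ => b + t • v := by
    refine LipschitzWith.of_dist_le_mul fun s t => ?_
    rw [dist_add_left, dist_eq_norm, ← sub_smul, norm_smul, mul_comm, dist_eq_norm, coe_nnnorm]
  exact hinner.comp ((lipschitzWith_perturbedArgmin hm hH).comp hline)

end PerturbedArgmin

/-! ### Adding one smooth loss term -/

/-- A differentiable convex loss on `ℝ` whose derivative is bounded by `ρ` and `β`-Lipschitz;
convexity is encoded as monotonicity of the derivative. -/
structure IsSmoothLoss (ρ β : ℝ≥0) (L : ℝ → ℝ) : Prop where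
  differentiable : Differentiable ℝ L
  monotone_deriv : Monotone (deriv L)
  abs_deriv_le : ∀ t, |deriv L t| ≤ ρ
  lipschitzWith_deriv : LipschitzWith β (deriv L)

/-- The multiple of `v` by which the perturbation `b` has to be moved so that the minimizer of
`H + ⟪b, ·⟫` stays put when the loss `L ⟪·, v⟫` is added to `H`. -/
noncomputable def perturbationShift {d : ℕ} (H : Vec d → ℝ) (L : ℝ → ℝ) (v b : Vec d) : ℝ :=
  -deriv L (inner ℝ (perturbedArgmin H b) v)

section SmoothLoss

variable {d : ℕ} {m ρ β : ℝ≥0} {H : Vec d → ℝ} {L : ℝ → ℝ}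

theorem IsSmoothLoss.convexOn (hL : IsSmoothLoss ρ β L) : ConvexOn ℝ univ L :=
  hL.monotone_deriv.convexOn_univ_of_deriv hL.differentiable

theorem IsSmoothLoss.convexOn_comp_inner (hL : IsSmoothLoss ρ β L) (v : Vec d) :
    ConvexOn ℝ univ fun u : Vec d => L (inner ℝ u v) :=
  hL.convexOn.comp_linearMap ((innerₗ (Vec d)).flip v)

theorem IsSmoothLoss.strongConvexOn_add (hL : IsSmoothLoss ρ β L) (hH : StrongConvexOn univ m H)
    (v : Vec d) : StrongConvexOn univ m fun u => H u + L (inner ℝ u v) :=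
  strongConvexOn_add_convexOn hH (hL.convexOn_comp_inner v)

theorem perturbedArgmin_add_perturbationShift (hm : 0 < m) (hH : StrongConvexOn univ m H)
    (hL : IsSmoothLoss ρ β L) (v b : Vec d) :
    perturbedArgmin (fun u => H u + L (inner ℝ u v)) (b + perturbationShift H L v b • v) =
      perturbedArgmin H b :=
  argmin_eq_of_isMinOn
    ((strongConvexOn_add_inner (hL.strongConvexOn_add hH v) _).strictConvexOn hm)
    (isMinOn_add_comp_inner hL.convexOn (hL.differentiable _) (isMinOn_perturbedArgmin hm hH b))

theorem measurable_perturbationShift (hm : 0 < m) (hH : StrongConvexOn univ m H)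
    (hL : IsSmoothLoss ρ β L) (v : Vec d) : Measurable (perturbationShift H L v) :=
  (hL.monotone_deriv.measurable.comp
    ((lipschitzWith_perturbedArgmin hm hH).continuous.measurable.inner measurable_const)).neg

theorem abs_perturbationShift_le (hL : IsSmoothLoss ρ β L) (v b : Vec d) :
    |perturbationShift H L v b| ≤ ρ :=
  (abs_neg _).trans_le (hL.abs_deriv_le _)

theorem monotone_perturbationShift_line (hm : 0 < m) (hH : StrongConvexOn univ m H)
    (hL : IsSmoothLoss ρ β L) (v b : Vec d) :
    Monotone fun t : ℝ => perturbationShift H L v (b + t • v) :=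
  (hL.monotone_deriv.comp_antitone (antitone_inner_perturbedArgmin_line hm hH b v)).neg

theorem lipschitzWith_perturbationShift_line (hm : 0 < m) (hH : StrongConvexOn univ m H)
    (hL : IsSmoothLoss ρ β L) {v : Vec d} (hv : ‖v‖ ≤ 1) (b : Vec d) :
    LipschitzWith (β / m) fun t : ℝ => perturbationShift H L v (b + t • v) := by
  refine (hL.lipschitzWith_deriv.comp
    (lipschitzWith_inner_perturbedArgmin_line hm hH b v)).neg.weaken ?_
  have hv' : ‖v‖₊ ≤ 1 := hv
  calc β * (‖v‖₊ * (m⁻¹ * ‖v‖₊)) ≤ β * (1 * (m⁻¹ * 1)) := by gcongr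
    _ = β / m := by rw [one_mul, mul_one, div_eq_mul_inv]

end SmoothLoss

/-! ### Shears with monotone Lipschitz displacement -/

section MonotoneDisplacement

variable {f : ℝ → ℝ} {k : ℝ≥0}

theorem antilipschitzWith_id_add_monotone (hf : Monotone f) :
    AntilipschitzWith 1 fun t => t + f t := by
  refine AntilipschitzWith.of_le_mul_dist fun s t => ?_
  wlog hst : s ≤ t generalizing s t
  · simpa only [dist_comm] using this t s (le_of_not_ge hst)
  have hfst := hf hst
  rw [NNReal.coe_one, one_mul, dist_comm, dist_comm (s + f s), Real.dist_eq, Real.dist_eq,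
    abs_of_nonneg (by linarith), abs_of_nonneg (by linarith)]
  linarith

theorem surjective_id_add_monotone (hf : Monotone f) (hcont : Continuous f) :
    Function.Surjective fun t => t + f t := by
  refine (continuous_id.add hcont).surjective ?_ ?_
  · refine tendsto_atTop_mono' _ ?_ (tendsto_atTop_add_const_right _ (f 0) tendsto_id)
    filter_upwards [eventually_ge_atTop 0] with t ht using add_le_add_right (hf ht) t
  · refine tendsto_atBot_mono' _ ?_ (tendsto_atBot_add_const_right _ (f 0) tendsto_id)
    filter_upwards [eventually_le_atBot 0] with t ht using add_le_add_right (hf ht) t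

theorem volume_preimage_id_add_le (hf : Monotone f) (s : Set ℝ) :
    volume ((fun t => t + f t) ⁻¹' s) ≤ volume s := by
  simpa [hausdorffMeasure_real] using
    (antilipschitzWith_id_add_monotone hf).hausdorffMeasure_preimage_le zero_le_one s

theorem volume_le_mul_volume_preimage_id_add (hf : Monotone f) (hlip : LipschitzWith k f)
    (s : Set ℝ) : volume s ≤ (1 + k : ℝ≥0) * volume ((fun t => t + f t) ⁻¹' s) := by
  have himage := (LipschitzWith.id.add hlip).hausdorffMeasure_image_le zero_le_one
    ((fun t => t + f t) ⁻¹' s)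
  rw [ENNReal.rpow_one, hausdorffMeasure_real] at himage
  simpa only [id, image_preimage_eq s (surjective_id_add_monotone hf hlip.continuous)] using himage

end MonotoneDisplacement

section Shear

variable {E : Type*} [NormedAddCommGroup E] [NormedSpace ℝ E] {v : E} {f : E → ℝ} {k : ℝ≥0}

/-- The shear along `v` that displaces the point `b` by `f b • v`. -/
def shear (v : E) (f : E → ℝ) (b : E) : E := b + f b • v

theorem shear_zero_left (f : E → ℝ) : shear 0 f = id :=
  funext fun b => by rw [shear, smul_zero, add_zero, id]

theorem shear_line (w : E) (t : ℝ) :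
    shear v f (w + t • v) = w + (t + f (w + t • v)) • v := by
  rw [shear, add_smul, add_assoc]

theorem exists_continuousLinearEquiv_prod_line [FiniteDimensional ℝ E] (hv : v ≠ 0) :
    ∃ (W : Submodule ℝ E) (e : (W × ℝ) ≃L[ℝ] E), ∀ w t, e (w, t) = w + t • v := by
  obtain ⟨W, hW⟩ := Submodule.exists_isCompl (ℝ ∙ v)
  let e : (W × ℝ) ≃ₗ[ℝ] E :=
    ((LinearEquiv.refl ℝ W).prodCongr (LinearEquiv.toSpanNonzeroSingleton ℝ E v hv)).trans
      (W.prodEquivOfIsCompl (ℝ ∙ v) hW.symm)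
  exact ⟨W, e.toContinuousLinearEquiv, fun w t => rfl⟩

variable [FiniteDimensional ℝ E] [MeasurableSpace E] [BorelSpace E]

theorem measurable_shear (hf : Measurable f) : Measurable (shear v f) :=
  measurable_id.add (hf.smul_const v)

variable (μ : Measure E) [μ.IsAddHaarMeasure]

theorem exists_measure_eq_lintegral_volume_lines (hv : v ≠ 0) :
    ∃ (W : Submodule ℝ E) (ν : Measure W), ∀ s, MeasurableSet s →
      μ s = ∫⁻ w, volume {t : ℝ | (w : E) + t • v ∈ s} ∂ν := by
  obtain ⟨W, e, he⟩ := exists_continuousLinearEquiv_prod_line hv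
  have he_meas : Measurable e := e.continuous.measurable
  let ν₀ : Measure W := Measure.addHaar
  have : ((ν₀.prod (volume : Measure ℝ)).map e).IsAddHaarMeasure := e.isAddHaarMeasure_map _
  refine ⟨W, μ.addHaarScalarFactor ((ν₀.prod volume).map e) • ν₀, fun s hs => ?_⟩
  conv_lhs => rw [Measure.isAddLeftInvariant_eq_smul μ ((ν₀.prod volume).map e)]
  rw [lintegral_smul_measure, Measure.smul_apply, Measure.map_apply he_meas hs,
    Measure.prod_apply (he_meas hs)]
  simp only [he, preimage]
  rfl

theorem map_shear_le (hf : Measurable f) (hmono : ∀ b, Monotone fun t : ℝ => f (b + t • v)) :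
    μ.map (shear v f) ≤ μ := by
  have hmeas : Measurable (shear v f) := measurable_shear hf
  rcases eq_or_ne v 0 with rfl | hv
  · rw [shear_zero_left, Measure.map_id]
  obtain ⟨W, ν, hν⟩ := exists_measure_eq_lintegral_volume_lines μ hv
  refine Measure.le_iff.2 fun s hs => ?_
  rw [Measure.map_apply hmeas hs, hν s hs, hν _ (hmeas hs)]
  refine lintegral_mono fun w => ?_
  simp only [mem_preimage, shear_line]
  exact volume_preimage_id_add_le (hmono w) {t : ℝ | (w : E) + t • v ∈ s}

theorem le_smul_map_shear (hf : Measurable f) (hmono : ∀ b, Monotone fun t : ℝ => f (b + t • v))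
    (hlip : ∀ b, LipschitzWith k fun t : ℝ => f (b + t • v)) :
    μ ≤ ((1 + k : ℝ≥0) : ℝ≥0∞) • μ.map (shear v f) := by
  have hmeas : Measurable (shear v f) := measurable_shear hf
  rcases eq_or_ne v 0 with rfl | hv
  · rw [shear_zero_left, Measure.map_id]
    exact Measure.le_iff.2 fun s _ => le_mul_of_one_le_left' (by exact_mod_cast le_self_add)
  obtain ⟨W, ν, hν⟩ := exists_measure_eq_lintegral_volume_lines μ hv
  refine Measure.le_iff.2 fun s hs => ?_
  rw [Measure.smul_apply, Measure.map_apply hmeas hs, hν s hs, hν _ (hmeas hs), smul_eq_mul,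
    ← lintegral_const_mul' _ _ ENNReal.coe_ne_top]
  refine lintegral_mono fun w => ?_
  simp only [mem_preimage, shear_line]
  exact volume_le_mul_volume_preimage_id_add (hmono w) (hlip w) {t : ℝ | (w : E) + t • v ∈ s}

end Shear

section WithDensity

variable {α : Type*} [MeasurableSpace α] {μ : Measure α} {T : α → α} {h : α → ℝ≥0∞} {a k : ℝ≥0∞}

theorem map_withDensity_le (hT : Measurable T) (hh : Measurable h) (hμ : μ.map T ≤ μ)
    (hle : ∀ x, h x ≤ a * h (T x)) : (μ.withDensity h).map T ≤ a • μ.withDensity h := by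
  refine Measure.le_iff.2 fun s hs => ?_
  rw [Measure.smul_apply, smul_eq_mul, Measure.map_apply hT hs, withDensity_apply _ (hT hs),
    withDensity_apply _ hs]
  calc ∫⁻ x in T ⁻¹' s, h x ∂μ ≤ ∫⁻ x in T ⁻¹' s, a * h (T x) ∂μ := lintegral_mono hle
    _ = a * ∫⁻ y in s, h y ∂μ.map T := by
      rw [setLIntegral_map hs hh hT]
      exact lintegral_const_mul _ (hh.comp hT)
    _ ≤ a * ∫⁻ y in s, h y ∂μ := by gcongr

theorem withDensity_le_map (hT : Measurable T) (hh : Measurable h) (hμ : μ ≤ k • μ.map T)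
    (hle : ∀ x, h (T x) ≤ a * h x) : μ.withDensity h ≤ (k * a) • (μ.withDensity h).map T := by
  refine Measure.le_iff.2 fun s hs => ?_
  rw [Measure.smul_apply, smul_eq_mul, Measure.map_apply hT hs, withDensity_apply _ (hT hs),
    withDensity_apply _ hs]
  calc ∫⁻ y in s, h y ∂μ ≤ ∫⁻ y in s, h y ∂(k • μ.map T) := by gcongr
    _ = k * ∫⁻ x in T ⁻¹' s, h (T x) ∂μ := by
      rw [Measure.restrict_smul, lintegral_smul_measure, smul_eq_mul, setLIntegral_map hs hh hT]
    _ ≤ k * ∫⁻ x in T ⁻¹' s, a * h x ∂μ := by gcongr with x; exact hle x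
    _ = k * a * ∫⁻ x in T ⁻¹' s, h x ∂μ := by rw [lintegral_const_mul _ hh, mul_assoc]

end WithDensity

/-! ### The noise law -/

section NoiseLaw

theorem integrable_exp_neg_mul_norm {E : Type*} [NormedAddCommGroup E] [NormedSpace ℝ E]
    [FiniteDimensional ℝ E] [MeasurableSpace E] [BorelSpace E] (μ : Measure E)
    [μ.IsAddHaarMeasure] {c : ℝ} (hc : 0 < c) :
    Integrable (fun b => Real.exp (-(c * ‖b‖))) μ := by
  have : ProperSpace E := FiniteDimensional.proper ℝ E
  let r : ℝ := Module.finrank ℝ E + 1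
  have tendsto_one_add_norm : Tendsto (fun b : E => 1 + ‖b‖) (cocompact E) atTop :=
    tendsto_atTop_add_const_left _ 1 (tendsto_norm_cocompact_atTop)
  have isLittleO_pow : (fun b : E => Real.exp (-c * (1 + ‖b‖))) =o[cocompact E]
      fun b => (1 + ‖b‖) ^ (-r) :=
    (isLittleO_exp_neg_mul_rpow_atTop hc (-r)).comp_tendsto tendsto_one_add_norm
  have exp_eq : (fun b : E => Real.exp (-(c * ‖b‖))) =
      fun b => Real.exp c * Real.exp (-c * (1 + ‖b‖)) := by
    funext b
    rw [← Real.exp_add]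
    ring_nf
  refine Continuous.locallyIntegrable (by fun_prop) |>.integrable_of_isBigO_cocompact
    (exp_eq ▸ (isLittleO_pow.const_mul_left (Real.exp c)).isBigO)
    ((integrable_one_add_norm (lt_add_one _)).integrableAtFilter _)

variable {d : ℕ} {c ρ : ℝ}

theorem lintegral_exp_neg_mul_norm_ne_zero :
    (∫⁻ b : Vec d, ENNReal.ofReal (Real.exp (-(c * ‖b‖)))) ≠ 0 := by
  rw [Ne, lintegral_eq_zero_iff (by fun_prop)]
  intro hzero
  obtain ⟨b, hb⟩ := hzero.exists
  exact (ENNReal.ofReal_pos.2 (Real.exp_pos _)).ne' hb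

theorem lintegral_exp_neg_mul_norm_ne_top (hc : 0 < c) :
    (∫⁻ b : Vec d, ENNReal.ofReal (Real.exp (-(c * ‖b‖)))) ≠ ∞ :=
  (integrable_exp_neg_mul_norm volume hc).lintegral_lt_top.ne

theorem isProbabilityMeasure_expNormLaw (hc : 0 < c) :
    IsProbabilityMeasure (expNormLaw d c) := by
  constructor
  rw [expNormLaw, Measure.smul_apply, withDensity_apply _ MeasurableSet.univ,
    Measure.restrict_univ, smul_eq_mul]
  exact ENNReal.inv_mul_cancel lintegral_exp_neg_mul_norm_ne_zero
    (lintegral_exp_neg_mul_norm_ne_top hc)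

theorem exp_neg_mul_norm_le {E : Type*} [SeminormedAddCommGroup E] (hc : 0 ≤ c) {a b : E}
    (hab : dist a b ≤ ρ) :
    ENNReal.ofReal (Real.exp (-(c * ‖a‖))) ≤
      ENNReal.ofReal (Real.exp (c * ρ)) * ENNReal.ofReal (Real.exp (-(c * ‖b‖))) := by
  rw [← ENNReal.ofReal_mul (Real.exp_pos _).le, ← Real.exp_add]
  have hnorm : ‖b‖ - ‖a‖ ≤ ρ :=
    (norm_sub_norm_le b a).trans (by rwa [← dist_eq_norm, dist_comm])
  have hmul := mul_le_mul_of_nonneg_left hnorm hc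
  gcongr
  linarith

variable {v : Vec d} {f : Vec d → ℝ} {k : ℝ≥0}

theorem dist_shear_le (hv : ‖v‖ ≤ 1) (hbound : ∀ b, |f b| ≤ ρ) (b : Vec d) :
    dist b (shear v f b) ≤ ρ := by
  rw [shear, dist_self_add_right, norm_smul]
  exact (mul_le_of_le_one_right (norm_nonneg _) hv).trans (hbound b)

theorem map_shear_expNormLaw_le (hc : 0 ≤ c) (hf : Measurable f)
    (hmono : ∀ b, Monotone fun t : ℝ => f (b + t • v)) (hv : ‖v‖ ≤ 1)
    (hbound : ∀ b, |f b| ≤ ρ) :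
    (expNormLaw d c).map (shear v f) ≤
      ENNReal.ofReal (Real.exp (c * ρ)) • expNormLaw d c := by
  rw [expNormLaw, Measure.map_smul, smul_comm]
  gcongr
  exact map_withDensity_le (measurable_shear hf) (by fun_prop) (map_shear_le volume hf hmono)
    fun b => exp_neg_mul_norm_le hc (dist_shear_le hv hbound b)

theorem expNormLaw_le_map_shear (hc : 0 ≤ c) (hf : Measurable f)
    (hmono : ∀ b, Monotone fun t : ℝ => f (b + t • v))
    (hlip : ∀ b, LipschitzWith k fun t : ℝ => f (b + t • v)) (hv : ‖v‖ ≤ 1)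
    (hbound : ∀ b, |f b| ≤ ρ) :
    expNormLaw d c ≤ (((1 + k : ℝ≥0) : ℝ≥0∞) * ENNReal.ofReal (Real.exp (c * ρ))) •
      (expNormLaw d c).map (shear v f) := by
  rw [expNormLaw, Measure.map_smul, smul_comm _ (_⁻¹ : ℝ≥0∞)]
  gcongr
  exact withDensity_le_map (measurable_shear hf) (by fun_prop)
    (le_smul_map_shear volume hf hmono hlip)
    fun b => exp_neg_mul_norm_le hc (dist_comm b _ ▸ dist_shear_le hv hbound b)

end NoiseLaw

/-! ### The law of the perturbed minimizer -/

section MinimizerLaw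

variable {d : ℕ} {c : ℝ} {m ρ β : ℝ≥0} {H : Vec d → ℝ} {L L' : ℝ → ℝ} {v v' : Vec d}

/-- The law of the minimizer of `H` under a random linear perturbation with density proportional
to `exp (-c ‖b‖)`. -/
noncomputable def minimizerLaw (c : ℝ) (H : Vec d → ℝ) : Measure (Vec d) :=
  (expNormLaw d c).map (perturbedArgmin H)

theorem minimizerLaw_eq_map_shear (hm : 0 < m) (hH : StrongConvexOn univ m H)
    (hL : IsSmoothLoss ρ β L) (v : Vec d) :
    minimizerLaw c H = ((expNormLaw d c).map (shear v (perturbationShift H L v))).map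
      (perturbedArgmin fun u => H u + L (inner ℝ u v)) := by
  rw [minimizerLaw, Measure.map_map
    (lipschitzWith_perturbedArgmin hm (hL.strongConvexOn_add hH v)).continuous.measurable
    (measurable_shear (measurable_perturbationShift hm hH hL v))]
  exact congrArg (Measure.map · _) <| funext fun b =>
    (perturbedArgmin_add_perturbationShift hm hH hL v b).symm

theorem minimizerLaw_le_minimizerLaw_add (hc : 0 ≤ c) (hm : 0 < m) (hH : StrongConvexOn univ m H)
    (hL : IsSmoothLoss ρ β L) (hv : ‖v‖ ≤ 1) :
    minimizerLaw c H ≤ ENNReal.ofReal (Real.exp (c * ρ)) •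
      minimizerLaw c fun u => H u + L (inner ℝ u v) := by
  have hargmin : Measurable (perturbedArgmin fun u => H u + L (inner ℝ u v)) :=
    (lipschitzWith_perturbedArgmin hm (hL.strongConvexOn_add hH v)).continuous.measurable
  rw [minimizerLaw_eq_map_shear hm hH hL v, minimizerLaw, ← Measure.map_smul]
  exact Measure.map_mono (map_shear_expNormLaw_le hc (measurable_perturbationShift hm hH hL v)
    (monotone_perturbationShift_line hm hH hL v) hv (abs_perturbationShift_le hL v)) hargmin

theorem minimizerLaw_add_le_minimizerLaw (hc : 0 ≤ c) (hm : 0 < m) (hH : StrongConvexOn univ m H)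
    (hL : IsSmoothLoss ρ β L) (hv : ‖v‖ ≤ 1) :
    minimizerLaw c (fun u => H u + L (inner ℝ u v)) ≤
      (((1 + β / m : ℝ≥0) : ℝ≥0∞) * ENNReal.ofReal (Real.exp (c * ρ))) • minimizerLaw c H := by
  have hargmin : Measurable (perturbedArgmin fun u => H u + L (inner ℝ u v)) :=
    (lipschitzWith_perturbedArgmin hm (hL.strongConvexOn_add hH v)).continuous.measurable
  rw [minimizerLaw_eq_map_shear hm hH hL v, minimizerLaw, ← Measure.map_smul]
  exact Measure.map_mono (expNormLaw_le_map_shear hc (measurable_perturbationShift hm hH hL v)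
    (monotone_perturbationShift_line hm hH hL v) (lipschitzWith_perturbationShift_line hm hH hL hv)
    hv (abs_perturbationShift_le hL v)) hargmin

theorem minimizerLaw_replace_loss_le (hc : 0 ≤ c) (hm : 0 < m) (hH : StrongConvexOn univ m H)
    (hL : IsSmoothLoss ρ β L) (hL' : IsSmoothLoss ρ β L') (hv : ‖v‖ ≤ 1) (hv' : ‖v'‖ ≤ 1) :
    minimizerLaw c (fun u => H u + L (inner ℝ u v)) ≤
      ENNReal.ofReal (Real.exp (2 * c * ρ) * (1 + β / m)) •
        minimizerLaw c fun u => H u + L' (inner ℝ u v') := by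
  have hconst : ENNReal.ofReal (Real.exp (2 * c * ρ) * (1 + β / m)) =
      ((1 + β / m : ℝ≥0) : ℝ≥0∞) * ENNReal.ofReal (Real.exp (c * ρ)) *
        ENNReal.ofReal (Real.exp (c * ρ)) := by
    rw [show 2 * c * ρ = c * ρ + c * ρ by ring, Real.exp_add, mul_comm, ← NNReal.coe_one,
      ← NNReal.coe_div, ← NNReal.coe_add, ENNReal.ofReal_mul NNReal.zero_le_coe,
      ENNReal.ofReal_mul (Real.exp_pos _).le, ENNReal.ofReal_coe_nnreal, mul_assoc]
  rw [hconst, ← smul_smul]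
  exact (minimizerLaw_add_le_minimizerLaw hc hm hH hL hv).trans
    (by gcongr; exact minimizerLaw_le_minimizerLaw_add hc hm hH hL' hv')

end MinimizerLaw

/-! ### The logistic loss -/

section LogisticLoss

theorem hasDerivAt_logisticLoss (y a : ℝ) :
    HasDerivAt (fun a => logisticLoss a y) (-(y * Real.sigmoid (-(y * a)))) a := by
  have hlog := (((hasDerivAt_const_mul (x := a) y).fun_neg).exp.const_add 1).log (by positivity)
  convert! hlog using 1
  rw [Real.sigmoid_def, neg_neg, Real.exp_neg]
  field_simp
  ring

theorem deriv_logisticLoss (y : ℝ) :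
    deriv (fun a => logisticLoss a y) = fun a => -(y * Real.sigmoid (-(y * a))) :=
  funext fun a => (hasDerivAt_logisticLoss y a).deriv

theorem hasDerivAt_deriv_logisticLoss (y a : ℝ) :
    HasDerivAt (deriv fun a => logisticLoss a y)
      (y ^ 2 * (Real.sigmoid (-(y * a)) * (1 - Real.sigmoid (-(y * a))))) a := by
  rw [deriv_logisticLoss]
  convert! (((Real.hasDerivAt_sigmoid (-(y * a))).comp a
    (hasDerivAt_const_mul (x := a) y).fun_neg).const_mul y).neg using 1
  ring

theorem sigmoid_mul_one_sub_nonneg (a : ℝ) : 0 ≤ Real.sigmoid a * (1 - Real.sigmoid a) :=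
  mul_nonneg (Real.sigmoid_nonneg a) (sub_nonneg.2 (Real.sigmoid_le_one a))

theorem sigmoid_mul_one_sub_le (a : ℝ) : Real.sigmoid a * (1 - Real.sigmoid a) ≤ 1 / 4 := by
  linarith [sq_nonneg (Real.sigmoid a - 1 / 2)]

theorem isSmoothLoss_logisticLoss {y : ℝ} (hy : |y| ≤ 1) :
    IsSmoothLoss 1 (1 / 4) fun a => logisticLoss a y where
  differentiable a := (hasDerivAt_logisticLoss y a).differentiableAt
  monotone_deriv := by
    refine monotone_of_deriv_nonneg
      (fun a => (hasDerivAt_deriv_logisticLoss y a).differentiableAt) fun a => ?_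
    rw [(hasDerivAt_deriv_logisticLoss y a).deriv]
    exact mul_nonneg (sq_nonneg y) (sigmoid_mul_one_sub_nonneg _)
  abs_deriv_le a := by
    rw [deriv_logisticLoss, abs_neg, abs_mul, abs_of_nonneg (Real.sigmoid_nonneg _)]
    exact mul_le_one₀ hy (Real.sigmoid_nonneg _) (Real.sigmoid_le_one _)
  lipschitzWith_deriv := by
    refine lipschitzWith_of_nnnorm_deriv_le
      (fun a => (hasDerivAt_deriv_logisticLoss y a).differentiableAt) fun a => ?_
    rw [(hasDerivAt_deriv_logisticLoss y a).deriv, ← NNReal.coe_le_coe, coe_nnnorm,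
      Real.norm_of_nonneg (mul_nonneg (sq_nonneg y) (sigmoid_mul_one_sub_nonneg _))]
    exact (mul_le_of_le_one_left (sigmoid_mul_one_sub_nonneg _)
      ((sq_le_one_iff_abs_le_one y).2 hy)).trans (sigmoid_mul_one_sub_le _)

end LogisticLoss

/-! ### Composition of private mechanisms -/

section Postprocessing

variable {ι α α' β γ : Type*} [MeasurableSpace β] [MeasurableSpace γ] {ε : ℝ}
  {M : (ι → α) → Measure β}

theorem isDifferentiallyPrivate_iff :
    IsDifferentiallyPrivate ε M ↔ (∀ D, IsProbabilityMeasure (M D)) ∧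
      ∀ D D', Neighbors D D' → M D ≤ ENNReal.ofReal (Real.exp ε) • M D' := by
  simp only [IsDifferentiallyPrivate, Measure.le_iff, Measure.smul_apply, smul_eq_mul]

theorem IsDifferentiallyPrivate.map (hM : IsDifferentiallyPrivate ε M) {f : β → γ}
    (hf : Measurable f) : IsDifferentiallyPrivate ε fun D => (M D).map f := by
  rw [isDifferentiallyPrivate_iff] at hM ⊢
  refine ⟨fun D => ?_, fun D D' h => ?_⟩
  · have := hM.1 D
    exact Measure.isProbabilityMeasure_map hf.aemeasurable
  · rw [← Measure.map_smul]
    exact Measure.map_mono (hM.2 D D' h) hf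

theorem IsDifferentiallyPrivate.comp_samplewise (hM : IsDifferentiallyPrivate ε M)
    (f : α' → α) : IsDifferentiallyPrivate ε fun D : ι → α' => M fun i => f (D i) :=
  ⟨fun _ => hM.1 _, fun _ _ ⟨i, hi⟩ => hM.2 _ _ ⟨i, fun j hj => congrArg f (hi j hj)⟩⟩

end Postprocessing

section Measure

variable {α β : Type*} [MeasurableSpace α] [MeasurableSpace β]

theorem bind_le_smul_bind_left {μ ν : Measure α} {κ : α → Measure β} (hκ : Measurable κ)
    {c : ℝ≥0∞} (h : μ ≤ c • ν) : μ.bind κ ≤ c • ν.bind κ := by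
  rw [← Measure.bind_smul]
  refine Measure.le_iff.2 fun T hT => ?_
  rw [Measure.bind_apply hT hκ.aemeasurable, Measure.bind_apply hT hκ.aemeasurable]
  exact lintegral_mono' h le_rfl

theorem bind_le_smul_bind_right (μ : Measure α) {κ η : α → Measure β} (hκ : Measurable κ)
    (hη : Measurable η) {c : ℝ≥0∞} (h : ∀ a, κ a ≤ c • η a) : μ.bind κ ≤ c • μ.bind η := by
  refine Measure.le_iff.2 fun T hT => ?_
  rw [Measure.smul_apply, smul_eq_mul, Measure.bind_apply hT hκ.aemeasurable,
    Measure.bind_apply hT hη.aemeasurable,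
    ← lintegral_const_mul c (f := fun a => η a T) ((Measure.measurable_coe hT).comp hη)]
  exact lintegral_mono fun a => h a T

theorem measurable_map_uncurry {γ : Type*} [MeasurableSpace γ] (μ : Measure β) [SFinite μ]
    {f : α → β → γ} (hf : Measurable (Function.uncurry f)) : Measurable fun a => μ.map (f a) := by
  convert! (Measure.measurable_map _ hf).comp (Measurable.map_prodMk_left (ν := μ)) using 2 with a
  exact (Measure.map_map hf measurable_prodMk_left).symm

theorem measurable_map_prodMk {κ : α → Measure β} (hκ : Measurable κ)
    [∀ a, IsProbabilityMeasure (κ a)] : Measurable fun a => (κ a).map (Prod.mk a) := by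
  let κ' : ProbabilityTheory.Kernel α β := ⟨κ, hκ⟩
  have : ProbabilityTheory.IsMarkovKernel κ' :=
    ⟨fun a => inferInstanceAs (IsProbabilityMeasure (κ a))⟩
  convert! (ProbabilityTheory.Kernel.id.prod κ').measurable using 2 with a
  rw [ProbabilityTheory.Kernel.prod_apply, ProbabilityTheory.Kernel.id_apply, Measure.dirac_prod]
  rfl

theorem pi_le_smul_pi {K : ℕ} {β : Fin K → Type*} [∀ k, MeasurableSpace (β k)]
    {μ ν : ∀ k, Measure (β k)} [∀ k, SigmaFinite (μ k)] [∀ k, SigmaFinite (ν k)] (k : Fin K)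
    (h : ∀ j, j ≠ k → μ j = ν j) {c : ℝ≥0∞} (hk : μ k ≤ c • ν k) :
    Measure.pi μ ≤ c • Measure.pi ν := by
  obtain _ | K := K
  · exact k.elim0
  have hrest : (fun j => μ (k.succAbove j)) = fun j => ν (k.succAbove j) :=
    funext fun j => h _ (Fin.succAbove_ne k j)
  rw [← (measurePreserving_piFinSuccAbove μ k).symm.map_eq,
    ← (measurePreserving_piFinSuccAbove ν k).symm.map_eq, ← Measure.map_smul,
    ← Measure.prod_smul_left, hrest]
  exact Measure.map_mono (Measure.prod_mono hk le_rfl) (MeasurableEquiv.measurable _)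

end Measure

section Partition

variable {N K : ℕ} {α : Type} {part : Fin N → Option (Fin K)}

theorem Neighbors.exists_subData {D D' : Fin N → α} (h : Neighbors D D') :
    ∃ p, Neighbors (subData part p D) (subData part p D') ∧
      ∀ q, q ≠ p → subData part q D = subData part q D' := by
  obtain ⟨i, hi⟩ := h
  refine ⟨part i, ⟨⟨i, rfl⟩, fun j hj => hi j fun hji => hj (Subtype.ext hji)⟩, fun q hq => ?_⟩
  exact funext fun j => hi j fun hji => hq (j.2 ▸ hji ▸ rfl)

theorem isDifferentiallyPrivate_parallel_bind {β γ : Type*} [MeasurableSpace β] [MeasurableSpace γ]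
    {ε : ℝ} {low : ∀ k, ({i // part i = some k} → α) → Measure β}
    {high : (Fin K → β) → ({i // part i = none} → α) → Measure γ}
    (hlow : ∀ k, IsDifferentiallyPrivate ε (low k))
    (hhigh : ∀ w, IsDifferentiallyPrivate ε (high w))
    (hmeas : ∀ D, Measurable fun w => high w D) :
    IsDifferentiallyPrivate ε fun D : Fin N → α =>
      (Measure.pi fun k => low k (subData part (some k) D)).bind fun w =>
        high w (subData part none D) := by
  simp only [isDifferentiallyPrivate_iff] at hlow hhigh ⊢
  have hprobLow := fun k => (hlow k).1
  refine ⟨fun D => isProbabilityMeasure_bind (hmeas _).aemeasurable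
    (.of_forall fun w => (hhigh w).1 _), fun D D' h => ?_⟩
  obtain ⟨_ | k, hpart, hother⟩ := h.exists_subData (part := part)
  · simp only [hother (some _) (Option.some_ne_none _)]
    exact bind_le_smul_bind_right _ (hmeas _) (hmeas _) fun w => (hhigh w).2 _ _ hpart
  · rw [hother none (Option.some_ne_none k).symm]
    refine bind_le_smul_bind_left (hmeas _) (pi_le_smul_pi k (fun j hj => ?_)
      ((hlow k).2 _ _ hpart))
    rw [hother (some j) fun hjk => hj (Option.some_injective _ hjk)]

end Partition
/-! ### Privacy of PLR -/

section EmpiricalRisk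

variable {ι : Type} [Fintype ι] {d : ℕ} {lam Δ : ℝ} {g : Vec d → ℝ}

/-- The objective of PLR without its noise term, multiplied by the number of samples and with
losses only for the samples in `S`; varying `S` singles out the loss of one sample. -/
noncomputable def empiricalRisk (lam Δ : ℝ) (g : Vec d → ℝ) (D : ι → Sample d) (S : Finset ι)
    (w : Vec d) : ℝ :=
  Fintype.card ι * (Δ * ‖w‖ ^ 2 / 2 + lam * g w) +
    ∑ i ∈ S, logisticLoss (inner ℝ w (D i).1) (D i).2

theorem isSmoothLoss_logisticLoss_label (z : Sample d) :
    IsSmoothLoss 1 (1 / 4) fun a => logisticLoss a z.2 :=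
  isSmoothLoss_logisticLoss (abs_le.2 z.2.2)

theorem strongConvexOn_regularizer (hlam : 0 ≤ lam) (hg : StrongConvexOn univ 1 g) :
    StrongConvexOn univ (Δ + lam) fun w => Δ * ‖w‖ ^ 2 / 2 + lam * g w := by
  rw [strongConvexOn_iff_convex] at hg ⊢
  convert! hg.smul hlam using 2 with w
  simp only [smul_eq_mul]
  ring

theorem strongConvexOn_empiricalRisk (hlam : 0 ≤ lam) (hg : StrongConvexOn univ 1 g)
    (D : ι → Sample d) (S : Finset ι) :
    StrongConvexOn univ (Fintype.card ι * (Δ + lam)) (empiricalRisk lam Δ g D S) := by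
  classical
  induction S using Finset.induction_on with
  | empty =>
    have hreg := (strongConvexOn_iff_convex.1
      (strongConvexOn_regularizer (Δ := Δ) hlam hg)).smul (Nat.cast_nonneg (Fintype.card ι))
    rw [strongConvexOn_iff_convex]
    convert! hreg using 2 with w
    simp only [empiricalRisk, Finset.sum_empty, smul_eq_mul]
    ring
  | insert i S hi ih =>
    convert! strongConvexOn_add_convexOn ih
      ((isSmoothLoss_logisticLoss_label (D i)).convexOn_comp_inner (D i).1) using 2 with w
    rw [empiricalRisk, empiricalRisk, Finset.sum_insert hi, add_comm (logisticLoss _ _), add_assoc]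

theorem empiricalRisk_univ [DecidableEq ι] (D : ι → Sample d) (i : ι) :
    empiricalRisk lam Δ g D Finset.univ = fun w =>
      empiricalRisk lam Δ g D (Finset.univ.erase i) w +
        logisticLoss (inner ℝ w (D i).1) (D i).2 := by
  funext w
  rw [empiricalRisk, empiricalRisk, add_assoc, Finset.sum_erase_add _ _ (Finset.mem_univ i)]

theorem empiricalRisk_congr {D D' : ι → Sample d} {S : Finset ι} (h : ∀ i ∈ S, D i = D' i) :
    empiricalRisk lam Δ g D S = empiricalRisk lam Δ g D' S := by
  funext w
  rw [empiricalRisk, empiricalRisk, Finset.sum_congr rfl fun i hi => by rw [h i hi]]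

theorem continuous_perturbedArgmin_empiricalRisk [Nonempty ι] (hlam : 0 ≤ lam)
    (hm : 0 < Δ + lam) (hg : StrongConvexOn univ 1 g) (S : Finset ι) :
    Continuous fun z : (ι → Sample d) × Vec d =>
      perturbedArgmin (empiricalRisk lam Δ g z.1 S) z.2 := by
  have hg_cont : Continuous g :=
    (hg.strictConvexOn one_pos).convexOn.locallyLipschitz.continuous
  have hn : (0 : ℝ) < Fintype.card ι := by exact_mod_cast Fintype.card_pos
  refine continuous_argmin ?_ (mul_pos hn hm) fun z =>
    strongConvexOn_add_inner (strongConvexOn_empiricalRisk hlam hg z.1 S) z.2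
  unfold Function.uncurry empiricalRisk logisticLoss
  fun_prop (disch := intros; positivity)

theorem argmin_objective_eq [Nonempty ι] (D : ι → Sample d) (b : Vec d) :
    argmin (objective lam Δ g D b) = perturbedArgmin (empiricalRisk lam Δ g D Finset.univ) b := by
  have hn : (0 : ℝ) < Fintype.card ι := by exact_mod_cast Fintype.card_pos
  rw [perturbedArgmin, ← argmin_const_mul hn]
  congr 1
  funext w
  rw [objective, empiricalRisk]
  field_simp
  ring

end EmpiricalRisk

section Budget

variable {ε lam : ℝ} {n : ℕ}

theorem modifiedBudget_pos (hε : 0 < ε) (lam : ℝ) (n : ℕ) : 0 < modifiedBudget ε lam n := by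
  rw [modifiedBudget]
  split_ifs with hslack
  exacts [hslack.2, half_pos hε]

theorem extraWeight_add_pos (hε : 0 < ε) (lam : ℝ) (hn : 0 < n) :
    0 < extraWeight ε lam n + lam := by
  rw [extraWeight]
  split_ifs with hslack
  · simpa only [zero_add] using hslack.1
  · have : 0 < Real.exp (ε / 4) - 1 := sub_pos.2 (Real.one_lt_exp_iff.2 (by positivity))
    rw [sub_add_cancel]
    positivity

theorem exp_modifiedBudget_mul_le (hε : 0 < ε) (lam : ℝ) (hn : 0 < n) :
    Real.exp (modifiedBudget ε lam n) * (1 + 1 / 4 / (n * (extraWeight ε lam n + lam))) ≤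
      Real.exp ε := by
  rw [modifiedBudget, extraWeight]
  split_ifs with hslack
  · have hlam := hslack.1
    have hsq : 1 + 1 / (2 * (n : ℝ) * lam) + 1 / (16 * (n : ℝ) ^ 2 * lam ^ 2) =
        (1 + 1 / 4 / (n * lam)) ^ 2 := by
      field_simp
      ring
    have hone : 1 ≤ 1 + 1 / 4 / (n * lam) := le_add_of_nonneg_right (by positivity)
    rw [zero_add, hsq, Real.exp_sub, Real.exp_log (by positivity), div_mul_eq_mul_div,
      div_le_iff₀ (by positivity)]
    gcongr
    exact le_self_pow₀ hone two_ne_zero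
  · have : 0 < Real.exp (ε / 4) - 1 := sub_pos.2 (Real.one_lt_exp_iff.2 (by positivity))
    have hfactor : 1 + 1 / 4 / (n * (4 * n * (Real.exp (ε / 4) - 1))⁻¹) = Real.exp (ε / 4) := by
      field_simp
      ring
    rw [sub_add_cancel, hfactor, ← Real.exp_add]
    gcongr
    linarith

end Budget

section Plr

variable {ι : Type} [Fintype ι] [Nonempty ι] {d : ℕ} {ε lam : ℝ} {g : Vec d → ℝ}

theorem plr_eq_minimizerLaw (s : ScalingRule d) (D : ι → Sample d) :
    plr ε lam g s D = minimizerLaw (modifiedBudget ε lam (Fintype.card ι) / 2)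
      (empiricalRisk lam (extraWeight ε lam (Fintype.card ι)) g (fun i => s.apply (D i))
        Finset.univ) := by
  simp only [plr, minimizerLaw, argmin_objective_eq]

theorem measurable_scalingRule_apply (s : ScalingRule d) : Measurable s.apply :=
  ((s.measurable_factor.comp measurable_fst).smul measurable_fst).prodMk measurable_snd

theorem measurable_plr (hε : 0 < ε) (hlam : 0 ≤ lam) (hg : StrongConvexOn univ 1 g)
    (s : ScalingRule d) : Measurable (plr (ι := ι) ε lam g s) := by
  have := isProbabilityMeasure_expNormLaw (d := d)
    (half_pos (modifiedBudget_pos hε lam (Fintype.card ι)))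
  have hscale : Measurable fun D : ι → Sample d => fun i => s.apply (D i) :=
    measurable_pi_lambda _ fun i => (measurable_scalingRule_apply s).comp (measurable_pi_apply i)
  have hargmin := (continuous_perturbedArgmin_empiricalRisk (ι := ι) hlam
    (extraWeight_add_pos hε lam (Fintype.card_pos (α := ι))) hg Finset.univ).measurable
  have huncurry : Measurable (Function.uncurry fun (D : ι → Sample d) b => perturbedArgmin
      (empiricalRisk lam (extraWeight ε lam (Fintype.card ι)) g (fun i => s.apply (D i))
        Finset.univ) b) := by
    simpa only [Function.comp_def, Function.uncurry_def] using
      hargmin.comp ((hscale.comp measurable_fst).prodMk measurable_snd)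
  rw [funext (plr_eq_minimizerLaw (ι := ι) s)]
  exact measurable_map_uncurry _ huncurry

theorem isProbabilityMeasure_plr (hε : 0 < ε) (hlam : 0 ≤ lam) (hg : StrongConvexOn univ 1 g)
    (s : ScalingRule d) (D : ι → Sample d) : IsProbabilityMeasure (plr ε lam g s D) := by
  have := isProbabilityMeasure_expNormLaw (d := d)
    (half_pos (modifiedBudget_pos hε lam (Fintype.card ι)))
  rw [plr_eq_minimizerLaw]
  exact Measure.isProbabilityMeasure_map ((continuous_perturbedArgmin_empiricalRisk hlam
    (extraWeight_add_pos hε lam Fintype.card_pos) hg _).comp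
      (Continuous.prodMk_right _)).measurable.aemeasurable

theorem plr_le_of_neighbors (hε : 0 < ε) (hlam : 0 ≤ lam) (hg : StrongConvexOn univ 1 g)
    (s : ScalingRule d) {D D' : ι → Sample d} (h : Neighbors D D') :
    plr ε lam g s D ≤ ENNReal.ofReal (Real.exp ε) • plr ε lam g s D' := by
  classical
  obtain ⟨i, hi⟩ := h
  have hn : 0 < Fintype.card ι := Fintype.card_pos
  have hc := half_pos (modifiedBudget_pos hε lam (Fintype.card ι))
  obtain ⟨m, hm⟩ : ∃ m : ℝ≥0,
      (m : ℝ) = Fintype.card ι * (extraWeight ε lam (Fintype.card ι) + lam) :=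
    CanLift.prf _ (mul_nonneg (Nat.cast_nonneg _) (extraWeight_add_pos hε lam hn).le)
  have hm_pos : 0 < m := by
    rw [← NNReal.coe_pos, hm]
    exact mul_pos (by exact_mod_cast hn) (extraWeight_add_pos hε lam hn)
  have hbudget := exp_modifiedBudget_mul_le hε lam hn
  have hreplace := minimizerLaw_replace_loss_le
    (v := (s.apply (D i)).1) (v' := (s.apply (D' i)).1) hc.le hm_pos
    (hm ▸ strongConvexOn_empiricalRisk hlam hg (fun j => s.apply (D j)) (Finset.univ.erase i))
    (isSmoothLoss_logisticLoss_label (s.apply (D i)))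
    (isSmoothLoss_logisticLoss_label (s.apply (D' i)))
    (s.norm_le_one (D i).1) (s.norm_le_one (D' i).1)
  have hcongr : ∀ j ∈ Finset.univ.erase i, s.apply (D' j) = s.apply (D j) := fun j hj => by
    rw [hi j (Finset.ne_of_mem_erase hj)]
  rw [plr_eq_minimizerLaw, plr_eq_minimizerLaw, empiricalRisk_univ _ i, empiricalRisk_univ _ i,
    empiricalRisk_congr hcongr]
  refine hreplace.trans ?_
  gcongr
  simpa [mul_div_cancel₀, hm] using hbudget

theorem isDifferentiallyPrivate_plr (hε : 0 < ε) (hlam : 0 ≤ lam) (hg : StrongConvexOn univ 1 g)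
    (s : ScalingRule d) : IsDifferentiallyPrivate ε (plr (ι := ι) ε lam g s) :=
  isDifferentiallyPrivate_iff.2
    ⟨isProbabilityMeasure_plr hε hlam hg s, fun _ _ => plr_le_of_neighbors hε hlam hg s⟩

end Plr

theorem measurable_metaSample {d K : ℕ} (z : Sample d) :
    Measurable fun w : Fin K → Vec d => metaSample w z := by
  refine Continuous.measurable ?_
  unfold metaSample
  fun_prop

end PrivStack

theorem mainTheorem3 (N K d : ℕ) (ε lam : ℝ) (hε : 0 < ε) (hlam : 0 ≤ lam)
    (gLow : PrivStack.Vec d → ℝ) (gHigh : PrivStack.Vec K → ℝ)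
    (hgLow : StrongConvexOn Set.univ 1 gLow) (hgHigh : StrongConvexOn Set.univ 1 gHigh)
    (sLow : PrivStack.ScalingRule d) (sHigh : PrivStack.ScalingRule K)
    (part : Fin N → Option (Fin K)) (hpart : Function.Surjective part) :
    PrivStack.IsDifferentiallyPrivate ε
      (PrivStack.pstS ε lam gLow gHigh sLow sHigh part) := by
  open PrivStack in
  have hne : ∀ p, Nonempty {i // part i = p} := fun p =>
    let ⟨i, hi⟩ := hpart p
    ⟨⟨i, hi⟩⟩
  have hlow := fun k => isDifferentiallyPrivate_plr (ι := {i // part i = some k}) hε hlam hgLow sLow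
  have hhigh := isDifferentiallyPrivate_plr (ι := {i // part i = none}) hε hlam hgHigh sHigh
  have hpair (w : Fin K → Vec d) := (hhigh.comp_samplewise (metaSample w)).map
    (measurable_prodMk_left (x := w))
  have hmeas (D : {i // part i = none} → Sample d) :
      Measurable fun w => (plr ε lam gHigh sHigh fun i => metaSample w (D i)).map (Prod.mk w) :=
    have hprob := hhigh.1
    measurable_map_prodMk <| (measurable_plr hε hlam hgHigh sHigh).comp <|
      measurable_pi_lambda _ fun i => measurable_metaSample (D i)
  exact (isDifferentiallyPrivate_parallel_bind hlow hpair hmeas :)
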